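/- Let $M,N\ge 0$ be integers and let $[\,\cdot\,]:\{1,\dots,M+N\}\to\{0,1\}$ be a $\mathbb Z_2$-grade taking the value $0$ exactly $M$ times (for instance the distinguished grade: $[i]=0$ for $i\le M$, $[i]=1$ for $i>M$). Let $\hbar\in\mathbb C\setminus\{0\}$. The super-Yangian $\mathcal Y(M|N)$ is the unital associative complex superalgebra with generators $T^{(n)}_{ab}$ of grade $[a]+[b]$ ($n>0$, $1\le a,b\le M+N$) and, with $T^{(0)}_{ab}=\delta_{ab}$ and $\eta(a,b,c)=[a]([b]+[c])+[b][c]$, the relations $$T^{(m)}_{ab}T^{(n)}_{cd}-(-1)^{([a]+[b])([c]+[d])}T^{(n)}_{cd}T^{(m)}_{ab}=(-1)^{\eta(a,b,c)}\sum_{r=0}^{\min(m,n)-1}\Big(T^{(r)}_{cb}T^{(m+n-1-r)}_{ad}-T^{(m+n-1-r)}_{cb}T^{(r)}_{ad}\Big)\qquad(m,n\ge 1).$$ Let $T(u)$ be the matrix with entries $T_{ab}(u)=\sum_{n\ge0}\hbar^n u^{-n}T^{(n)}_{ab}$, and let $T^{-1}(u)=(T'_{ab}(u))$ be its inverse as a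 matrix of power series in $u^{-1}$ (so $\sum_c T_{ac}(u)T'_{cb}(u)=\delta_{ab}$). Let $\xi\in\mathbb C$ and $0\le L_1\le L_2\le M+N$, and let $K(u)$ be the diagonal matrix with $K_{jj}(u)=\xi-u$ for $j\le L_1$ and for $j>L_2$, and $K_{jj}(u)=\xi+u$ for $L_1<j\le L_2$. Put $B(u)=T(u)K(u)T^{-1}(-u)$, i.e. $B_{kl}(u)=\sum_j T_{kj}(u)K_{jj}(u)T'_{jl}(-u)$, a Laurent series in $u^{-1}$; the reflection superalgebra $\mathfrak B\subseteq\mathcal Y(M|N)$ is the subalgebra generated by the coefficients of all $B_{kl}(u)$. Let $V$ be a representation of $\mathcal Y(M|N)$ and let $v^+\in V$ be a highest weight vector: $v^+\neq0$, $T_{aa}(u)v^+=\lambda_a(u)v^+$ with $\lambda_a(u)\in1+u^{-1}\mathbb C[[u^{-1}]]$ for all $a$, and $T_{ab}(u)v^+=0$ for $b<a$. Then $v^+$ is an eigenvector of every $T'_{kk}(u)$, say $T'_{kk}(u)v^+=\lambda'_k(u)v^+$ with $\lambda'_k(u)\in\mathbb C[[u^{-1}]]$, and $v^+$ is a highest weight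 vector of the representation of $\mathfrak B$ on $V$ obtained by restriction, in the following sense: $$B_{kl}(u)\,v^+=0\qquad(1\le l<k\le M+N),$$ $$B_{kk}(u)\,v^+=\frac{2u}{2u-\hbar c_{k-1}}\,g_k(u)\,\lambda_k(u)\,\lambda'_k(-u)\,v^+-\sum_{j=1}^{k-1}g_j(u)\,a_j(u)\,v^+\qquad(1\le k\le M+N),$$ where $c_k=\sum_{a=1}^k(-1)^{[a]}$, $$g_k(u)=\begin{cases}\xi-u,&1\le k\le L_1,\\ \xi+u-\hbar c_{L_1},&L_1<k\le L_2,\\ \xi-u-\hbar(c_{L_1}-c_{L_2}),&L_2<k\le M+N,\end{cases}\qquad a_k(u)=(-1)^{[k]}\hbar\,\frac{2u\,\lambda_k(u)\,\lambda'_k(-u)}{(2u-\hbar c_k)(2u-\hbar c_{k-1})},$$ and all identities are between formal Laurent series in $u^{-1}$. -/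

import Mathlib

open scoped PowerSeries

noncomputable section

/-! ### The super-Yangian -/

/-- The generators `T_{ab}^{(n)}` of the super-Yangian, with `n > 0`. -/
abbrev SuperYangianGen (d : ℕ) : Type := Fin d × Fin d × ℕ+

/-- The symbol `T_{ab}^{(n)}` in the free algebra, with the convention `T_{ab}^{(0)} = δ_{ab}`. -/
def freeT {d : ℕ} (n : ℕ) (a b : Fin d) : FreeAlgebra ℂ (SuperYangianGen d) :=
  if h : 0 < n then FreeAlgebra.ι ℂ (a, b, ⟨n, h⟩) else if a = b then 1 else 0

/-- The defining relations of the super-Yangian for the `ℤ/2`-grade `p` (so that `T_{ab}^{(n)}` has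
grade `[a] + [b]`): the modes of the exchange relation `R₁₂(u-v) T₁(u) T₂(v) = T₂(v) T₁(u) R₁₂(u-v)`
with `R₁₂(u) = u - ℏ P₁₂`. The left-hand side is the supercommutator of `T_{ab}^{(m)}` and
`T_{cd}^{(n)}`. -/
inductive SuperYangianRel {d : ℕ} (p : Fin d → Fin 2) :
    FreeAlgebra ℂ (SuperYangianGen d) → FreeAlgebra ℂ (SuperYangianGen d) → Prop
  | comm (a b c e : Fin d) (m n : ℕ) (hm : 0 < m) (hn : 0 < n) :
      SuperYangianRel p
        (freeT m a b * freeT n c e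
          - ((-1 : ℂ) ^ (((p a : ℕ) + (p b : ℕ)) * ((p c : ℕ) + (p e : ℕ)))) •
              (freeT n c e * freeT m a b))
        (((-1 : ℂ) ^ ((p a : ℕ) * ((p b : ℕ) + (p c : ℕ)) + (p b : ℕ) * (p c : ℕ))) •
          ∑ r ∈ Finset.range (min m n),
            (freeT r c b * freeT (m + n - 1 - r) a e - freeT (m + n - 1 - r) c b * freeT r a e))

/-- The super-Yangian attached to the grade `p` of the basis vectors, as an associative unital
complex algebra. -/
def SuperYangian {d : ℕ} (p : Fin d → Fin 2) : Type := RingQuot (SuperYangianRel p)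

instance {d : ℕ} (p : Fin d → Fin 2) : Ring (SuperYangian p) :=
  inferInstanceAs (Ring (RingQuot (SuperYangianRel p)))

instance {d : ℕ} (p : Fin d → Fin 2) : Algebra ℂ (SuperYangian p) :=
  inferInstanceAs (Algebra ℂ (RingQuot (SuperYangianRel p)))

namespace SuperYangian

variable {d : ℕ} (p : Fin d → Fin 2)

/-- The matrix `T^{(n)} = (T_{ab}^{(n)})`, with `T^{(0)} = 1`. -/
def T (n : ℕ) : Matrix (Fin d) (Fin d) (SuperYangian p) :=
  Matrix.of fun a b => RingQuot.mkAlgHom ℂ (SuperYangianRel p) (freeT n a b)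

/-- `T(u) = ∑_{n ≥ 0} ℏⁿ u⁻ⁿ T^{(n)}`, as a power series in `X = u⁻¹` with matrix coefficients. -/
def Tser (hbar : ℂ) : (Matrix (Fin d) (Fin d) (SuperYangian p))⟦X⟧ :=
  PowerSeries.mk fun n => hbar ^ n • T p n

/-- The inverse `T⁻¹(u)` of `T(u)`, a power series in `X = u⁻¹`. -/
def TserInv (hbar : ℂ) : (Matrix (Fin d) (Fin d) (SuperYangian p))⟦X⟧ :=
  PowerSeries.invOfUnit (Tser p hbar) 1

theorem T_zero : T p 0 = 1 := by
  ext a b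
  change RingQuot.mkAlgHom ℂ (SuperYangianRel p) (freeT 0 a b) = _
  by_cases h : a = b
  · have : freeT 0 a b = 1 := by simp [freeT, h]
    rw [this, map_one, h, Matrix.one_apply_eq]
    rfl
  · have : freeT 0 a b = 0 := by simp [freeT, h]
    rw [this, map_zero, Matrix.one_apply_ne h]
    rfl

theorem constantCoeff_Tser (hbar : ℂ) :
    PowerSeries.constantCoeff (Tser p hbar) =
      ((1 : (Matrix (Fin d) (Fin d) (SuperYangian p))ˣ) :
        Matrix (Fin d) (Fin d) (SuperYangian p)) := by
  rw [← PowerSeries.coeff_zero_eq_constantCoeff_apply]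
  simp [Tser, T_zero]

theorem Tser_mul_TserInv (hbar : ℂ) : Tser p hbar * TserInv p hbar = 1 :=
  PowerSeries.mul_invOfUnit _ _ (constantCoeff_Tser p hbar)

theorem TserInv_mul_Tser (hbar : ℂ) : TserInv p hbar * Tser p hbar = 1 :=
  PowerSeries.invOfUnit_mul _ _ (constantCoeff_Tser p hbar)

end SuperYangian

/-- The substitution `u ↦ -u` in a power series in `u⁻¹`. -/
def negVar {R : Type*} [Ring R] (f : R⟦X⟧) : R⟦X⟧ :=
  PowerSeries.mk fun n => (-1) ^ n * PowerSeries.coeff n f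

/-- A power series in `u⁻¹`, seen as a Laurent series in `u⁻¹`. -/
def toLaurent {R : Type*} [Ring R] (f : R⟦X⟧) : LaurentSeries R := HahnSeries.ofPowerSeries ℤ R f

/-- The element `u` of `R((u⁻¹))`. -/
def uVar (R : Type*) [Ring R] : LaurentSeries R := HahnSeries.single (-1) 1

/-! ### The reflection superalgebra -/

/-- The sign `θ_i`: the first `L₁` are `-1`, the next `L₂ - L₁` are `1`, the remaining ones `-1`.
(The `0`-based index `i : Fin d` stands for the `1`-based index `i + 1`.) -/
def thetaSign {d : ℕ} (L₁ L₂ : ℕ) (i : Fin d) : ℂ :=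
  if (i : ℕ) < L₁ then -1 else if (i : ℕ) < L₂ then 1 else -1

/-- The boundary matrix `K(u) = u diag(θ) + ξ`, that is
`diag(ξ-u, …, ξ-u, ξ+u, …, ξ+u, ξ-u, …, ξ-u)`. -/
def Kmat {d : ℕ} (p : Fin d → Fin 2) (xi : ℂ) (L₁ L₂ : ℕ) :
    LaurentSeries (Matrix (Fin d) (Fin d) (SuperYangian p)) :=
  uVar _ * HahnSeries.C (Matrix.diagonal fun i => algebraMap ℂ (SuperYangian p) (thetaSign L₁ L₂ i))
    + HahnSeries.C (Matrix.diagonal fun _ => algebraMap ℂ (SuperYangian p) xi)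

/-- `B(u) = T(u) K(u) T⁻¹(-u)`. -/
def Bmat {d : ℕ} (p : Fin d → Fin 2) (hbar xi : ℂ) (L₁ L₂ : ℕ) :
    LaurentSeries (Matrix (Fin d) (Fin d) (SuperYangian p)) :=
  toLaurent (SuperYangian.Tser p hbar) * Kmat p xi L₁ L₂ *
    toLaurent (negVar (SuperYangian.TserInv p hbar))

/-- The reflection superalgebra: the subalgebra of the super-Yangian generated by all the
coefficients of all the entries of `B(u)`. -/
def reflectionSuperalgebra {d : ℕ} (p : Fin d → Fin 2) (hbar xi : ℂ) (L₁ L₂ : ℕ) :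
    Subalgebra ℂ (SuperYangian p) :=
  Algebra.adjoin ℂ {x | ∃ (n : ℤ) (k l : Fin d), x = (Bmat p hbar xi L₁ L₂).coeff n k l}

/-- The coefficient of `u⁻ⁿ` in `B_{kl}(u)`, as an element of the reflection superalgebra. -/
def Bgen {d : ℕ} (p : Fin d → Fin 2) (hbar xi : ℂ) (L₁ L₂ : ℕ) (n : ℤ) (k l : Fin d) :
    reflectionSuperalgebra p hbar xi L₁ L₂ :=
  ⟨(Bmat p hbar xi L₁ L₂).coeff n k l, Algebra.subset_adjoin ⟨n, k, l, rfl⟩⟩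

/-! ### Highest weight vectors -/

/-- `v` is a highest weight vector, of highest weight `lam`, of the representation `ρ` of the
super-Yangian: `v ≠ 0`, `T_{aa}(u) v = λ_a(u) v` with `λ_a(u) ∈ 1 + u⁻¹ ℂ[[u⁻¹]]` for all `a`, and
`T_{ab}(u) v = 0` for `b < a`. -/
structure IsHighestWeightVector {d : ℕ} {p : Fin d → Fin 2} (hbar : ℂ) {V : Type*}
    [AddCommGroup V] [Module ℂ V] (ρ : SuperYangian p →ₐ[ℂ] Module.End ℂ V) (v : V)
    (lam : Fin d → ℂ⟦X⟧) : Prop where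
  ne_zero : v ≠ 0
  constantCoeff_eq_one : ∀ a, PowerSeries.constantCoeff (lam a) = 1
  diag : ∀ a n, ρ (PowerSeries.coeff n (SuperYangian.Tser p hbar) a a) v =
    PowerSeries.coeff n (lam a) • v
  lower : ∀ a b, b < a → ∀ n, ρ (PowerSeries.coeff n (SuperYangian.Tser p hbar) a b) v = 0

/-- The integer `c_k = ∑_{a=1}^k (-1)^{[a]}`. -/
def cInt {d : ℕ} (p : Fin d → Fin 2) (k : ℕ) : ℤ :=
  ∑ a : Fin d, if (a : ℕ) < k then (-1) ^ (p a : ℕ) else 0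

/-- `ℏ c_k` as a constant in `ℂ((u⁻¹))`. -/
def hc {d : ℕ} (p : Fin d → Fin 2) (hbar : ℂ) (k : ℕ) : LaurentSeries ℂ :=
  HahnSeries.C (hbar * (cInt p k : ℂ))

/-- The function `g_k(u)`; the `0`-based index `k : Fin d` stands for the `1`-based `k + 1`. -/
def gFun {d : ℕ} (p : Fin d → Fin 2) (hbar xi : ℂ) (L₁ L₂ : ℕ) (k : Fin d) : LaurentSeries ℂ :=
  if (k : ℕ) < L₁ then HahnSeries.C xi - uVar ℂ
  else if (k : ℕ) < L₂ then HahnSeries.C xi + uVar ℂ - hc p hbar L₁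
  else HahnSeries.C xi - uVar ℂ - (hc p hbar L₁ - hc p hbar L₂)

/-- The function `a_k(u) = (-1)^{[k]} ℏ · 2u λ_k(u) λ'_k(-u) / ((2u - ℏ c_k)(2u - ℏ c_{k-1}))`,
computed in the field `ℂ((u⁻¹))`; the `0`-based index `k : Fin d` stands for the `1`-based
`k + 1`. -/
def aFun {d : ℕ} (p : Fin d → Fin 2) (hbar : ℂ) (lam lam' : Fin d → ℂ⟦X⟧) (k : Fin d) :
    LaurentSeries ℂ :=
  HahnSeries.C ((-1) ^ (p k : ℕ) * hbar) *
    (2 * uVar ℂ * toLaurent (lam k) * toLaurent (negVar (lam' k)) /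
      ((2 * uVar ℂ - hc p hbar (k + 1)) * (2 * uVar ℂ - hc p hbar k)))

/-- The eigenvalue of `B_{kk}(u)` on the highest weight vector. -/
def BEigenvalue {d : ℕ} (p : Fin d → Fin 2) (hbar xi : ℂ) (L₁ L₂ : ℕ)
    (lam lam' : Fin d → ℂ⟦X⟧) (k : Fin d) : LaurentSeries ℂ :=
  2 * uVar ℂ / (2 * uVar ℂ - hc p hbar k) * gFun p hbar xi L₁ L₂ k *
      toLaurent (lam k) * toLaurent (negVar (lam' k))
    - ∑ j ∈ Finset.Iio k, gFun p hbar xi L₁ L₂ j * aFun p hbar lam lam' j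

end

noncomputable section

/-! ### The exchange relations of the super-Yangian -/

namespace SuperYangian

variable {d : ℕ} (p : Fin d → Fin 2)

/-! Conjugating the exchange relation by `T⁻¹` shows that, up to signs, `u - w` times the
supercommutator of `T_{ab}(u)` and `T'_{gf}(w)` is `ℏ` times a combination of `∑_c T'_{gc}(w)
T_{cb}(u)`, present only if `a = f`, and `∑_c T_{ac}(u) T'_{cf}(w)`, present only if `g = b`
(`tInvMode_exchange`).

Applied to `v` with `j < k`, the products `T'_{jl}(w) T_{kj}(u)` vanish, so `u - w` times `T_{kj}(u)
T'_{jl}(w) v` is a combination of such row sums. In modes the row sums have smaller total degree.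
Induction on that degree shows that the products kill `v` when `l < k`, and that for `l = k` they,
like the opposite products `T'_{kj} T_{jk}`, act on `v` by scalars.

Now set `w = -u`, so that `u - w` becomes `x = 2u`. Let `A_{kj}` and `C_{kj}` be the scalars of
`T_{kj}(u) T'_{jk}(-u)` and `T'_{kj}(-u) T_{jk}(u)`, with row sums `S_k` and `Z_k`, and let `s_j =
(-1)^{[j]}`. For `j < k`, `x A_{kj} = ℏ s_j (S_k - Z_j)` and `x C_{kj} = ℏ s_j (Z_k - S_j)`; entries
with `j > k` vanish, and both diagonals are `λ_k(u) λ'_k(-u)`. This symmetric system forces `S = Z`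
(`triangular_system_unique`), and the eigenvalue `∑_j K_j A_{kj}` of `B_{kk}(u)` then follows by
telescoping in `k` (`triangular_system_solution`). -/

theorem T_comm_of_pos (a b c e : Fin d) {m n : ℕ} (hm : 0 < m) (hn : 0 < n) :
    T p m a b * T p n c e
      - ((-1 : ℂ) ^ (((p a : ℕ) + (p b : ℕ)) * ((p c : ℕ) + (p e : ℕ)))) •
          (T p n c e * T p m a b) =
    ((-1 : ℂ) ^ ((p a : ℕ) * ((p b : ℕ) + (p c : ℕ)) + (p b : ℕ) * (p c : ℕ))) •
      ∑ r ∈ Finset.range (min m n),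
        (T p r c b * T p (m + n - 1 - r) a e - T p (m + n - 1 - r) c b * T p r a e) := by
  have h := RingQuot.mkAlgHom_rel ℂ (SuperYangianRel.comm (p := p) a b c e m n hm hn)
  rw [map_sub, map_smul, map_smul, map_sum, map_mul, map_mul] at h
  simp only [map_sub, map_mul] at h
  exact h

theorem T_comm (a b c e : Fin d) (m n : ℕ) :
    T p m a b * T p n c e
      - ((-1 : ℂ) ^ (((p a : ℕ) + (p b : ℕ)) * ((p c : ℕ) + (p e : ℕ)))) •
          (T p n c e * T p m a b) =
    ((-1 : ℂ) ^ ((p a : ℕ) * ((p b : ℕ) + (p c : ℕ)) + (p b : ℕ) * (p c : ℕ))) •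
      ∑ r ∈ Finset.range (min m n),
        (T p r c b * T p (m + n - 1 - r) a e - T p (m + n - 1 - r) c b * T p r a e) := by
  rcases Nat.eq_zero_or_pos m with rfl | hm
  · rcases eq_or_ne a b with rfl | hab
    · simp [T_zero, ← two_mul, mul_assoc, pow_mul]
    · simp [T_zero, Matrix.one_apply_ne hab]
  rcases Nat.eq_zero_or_pos n with rfl | hn
  · rcases eq_or_ne c e with rfl | hab
    · have : (-1 : ℂ) ^ (((p a : ℕ) + (p b : ℕ)) * ((p c : ℕ) + (p c : ℕ))) = 1 := by
        rw [← two_mul, mul_left_comm, pow_mul]; simp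
      simp [T_zero, this]
    · simp [T_zero, Matrix.one_apply_ne hab]
  exact T_comm_of_pos p a b c e hm hn

/-- This is the relation cleared of its denominator `u - v`: the two sums have the same total degree
`m + n`, so their difference telescopes. -/
theorem T_exchange (a b c e : Fin d) (m n : ℕ) :
    (T p (m + 1) a b * T p n c e
      - ((-1 : ℂ) ^ (((p a : ℕ) + (p b : ℕ)) * ((p c : ℕ) + (p e : ℕ)))) •
          (T p n c e * T p (m + 1) a b))
    - (T p m a b * T p (n + 1) c e
      - ((-1 : ℂ) ^ (((p a : ℕ) + (p b : ℕ)) * ((p c : ℕ) + (p e : ℕ)))) •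
          (T p (n + 1) c e * T p m a b)) =
    ((-1 : ℂ) ^ ((p a : ℕ) * ((p b : ℕ) + (p c : ℕ)) + (p b : ℕ) * (p c : ℕ))) •
      (T p m c b * T p n a e - T p n c b * T p m a e) := by
  rw [T_comm, T_comm, ← smul_sub]
  congr 1
  have h1 : m + 1 + n - 1 = m + n := by omega
  have h2 : m + (n + 1) - 1 = m + n := by omega
  rw [h1, h2]
  -- The ranges `min (m + 1) n` and `min m (n + 1)` differ by the single index `r = min m n`, or
  -- coincide when `m = n`, where the right-hand side vanishes too.
  rcases lt_trichotomy m n with h | rfl | h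
  · rw [min_eq_left (by omega : m + 1 ≤ n), min_eq_left (by omega : m ≤ n + 1),
      Finset.sum_range_succ, add_sub_cancel_left, Nat.add_sub_cancel_left]
  · rw [min_eq_right (by omega : m ≤ m + 1), min_eq_left (by omega : m ≤ m + 1), sub_self, sub_self]
  · rw [min_eq_right (by omega : n ≤ m + 1), min_eq_right (by omega : n + 1 ≤ m),
      Finset.sum_range_succ, sub_add_cancel_left, Nat.add_sub_cancel, neg_sub]

variable (hbar : ℂ)

/-- The modes of `T(u)`, including the powers of `ℏ`. -/
def tMode (n : ℕ) : Matrix (Fin d) (Fin d) (SuperYangian p) :=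
  PowerSeries.coeff n (Tser p hbar)

/-- The modes of `T⁻¹(u)`. -/
def tInvMode (n : ℕ) : Matrix (Fin d) (Fin d) (SuperYangian p) :=
  PowerSeries.coeff n (TserInv p hbar)

theorem tMode_eq (n : ℕ) : tMode p hbar n = hbar ^ n • T p n := by
  simp [tMode, Tser]

theorem tMode_zero : tMode p hbar 0 = 1 := by
  simp [tMode_eq, T_zero]

theorem sum_tMode_mul_tInvMode (n : ℕ) :
    ∑ q ∈ Finset.HasAntidiagonal.antidiagonal n, tMode p hbar q.1 * tInvMode p hbar q.2 =
      if n = 0 then 1 else 0 := by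
  have h := congrArg (PowerSeries.coeff n) (Tser_mul_TserInv p hbar)
  rwa [PowerSeries.coeff_mul, PowerSeries.coeff_one] at h

theorem tInvMode_zero : tInvMode p hbar 0 = 1 := by
  simpa [tMode_zero] using sum_tMode_mul_tInvMode p hbar 0

/-- The diagonal matrix that carries `T_{ab}^{(m)}` with the Koszul signs of moving it past the
rows of a matrix. -/
def koszulDiag (a b : Fin d) (m : ℕ) : Matrix (Fin d) (Fin d) (SuperYangian p) :=
  Matrix.diagonal fun i => ((-1 : ℂ) ^ (((p a : ℕ) + (p b : ℕ)) * (p i : ℕ))) • tMode p hbar m a b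

/-- With the Koszul signs stored in a diagonal matrix, the supercommutators with all entries of
`T(u)` form one ordinary matrix commutator, which can be conjugated by `T⁻¹(u)` without further
signs. -/
theorem koszulDiag_exchange (a b : Fin d) (m n : ℕ) :
    (koszulDiag p hbar a b (m + 1) * tMode p hbar n
        - tMode p hbar n * koszulDiag p hbar a b (m + 1))
      - (koszulDiag p hbar a b m * tMode p hbar (n + 1)
        - tMode p hbar (n + 1) * koszulDiag p hbar a b m) =
    (hbar * (-1) ^ ((p a : ℕ) * (p b : ℕ))) •
      (tMode p hbar m * Matrix.single b a 1 * tMode p hbar n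
        - tMode p hbar n * Matrix.single b a 1 * tMode p hbar m) := by
  have hsing : ∀ (X Y : Matrix (Fin d) (Fin d) (SuperYangian p)) (c e : Fin d),
      (X * Matrix.single b a (1 : SuperYangian p) * Y : Matrix _ _ _) c e = X c b * Y a e := by
    intro X Y c e
    rw [Matrix.mul_apply, Finset.sum_eq_single a]
    · simp
    · intro j _ hj
      rw [Matrix.mul_single_apply_of_ne _ _ _ _ _ hj, zero_mul]
    · simp
  ext c e
  -- The left side has total degree `m + n + 1` and the right side `m + n`, so one factor `ℏ`
  -- survives on the right. The sign is that of row `c`.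
  have h := congrArg (fun y => (hbar ^ (m + n + 1) *
    (-1) ^ (((p a : ℕ) + (p b : ℕ)) * (p c : ℕ))) • y) (T_exchange p a b c e m n)
  have s1 : (-1 : ℂ) ^ (((p a : ℕ) + (p b : ℕ)) * (p c : ℕ)) *
      (-1) ^ (((p a : ℕ) + (p b : ℕ)) * ((p c : ℕ) + (p e : ℕ))) =
      (-1) ^ (((p a : ℕ) + (p b : ℕ)) * (p e : ℕ)) := by
    rw [mul_add, pow_add, ← mul_assoc, ← pow_add, ← two_mul, pow_mul]; simp
  have s2 : (-1 : ℂ) ^ (((p a : ℕ) + (p b : ℕ)) * (p c : ℕ)) *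
      (-1) ^ ((p a : ℕ) * ((p b : ℕ) + (p c : ℕ)) + (p b : ℕ) * (p c : ℕ)) =
      (-1) ^ ((p a : ℕ) * (p b : ℕ)) := by
    rw [← pow_add]
    have : ((p a : ℕ) + (p b : ℕ)) * (p c : ℕ) +
      ((p a : ℕ) * ((p b : ℕ) + (p c : ℕ)) + (p b : ℕ) * (p c : ℕ)) =
      2 * (((p a : ℕ) + (p b : ℕ)) * (p c : ℕ)) + (p a : ℕ) * (p b : ℕ) := by ring
    rw [this, pow_add, pow_mul]; simp
  simp only [Matrix.sub_apply, Matrix.smul_apply, hsing, koszulDiag, Matrix.diagonal_mul,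
    Matrix.mul_diagonal, tMode_eq, smul_mul_assoc, mul_smul_comm, smul_smul, smul_sub] at h ⊢
  rw [← s1, ← s2]
  convert h using 1
  · congr 1 <;> congr 1 <;> congr 1 <;> ring
  · congr 1 <;> congr 1 <;> ring

theorem koszulDiag_exchange_series (a b : Fin d) (m : ℕ) :
    PowerSeries.X * (PowerSeries.C (koszulDiag p hbar a b (m + 1)) * Tser p hbar
        - Tser p hbar * PowerSeries.C (koszulDiag p hbar a b (m + 1)))
      - (PowerSeries.C (koszulDiag p hbar a b m) * Tser p hbar
        - Tser p hbar * PowerSeries.C (koszulDiag p hbar a b m)) =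
    (hbar * (-1) ^ ((p a : ℕ) * (p b : ℕ))) • (PowerSeries.X *
      (PowerSeries.C (tMode p hbar m * Matrix.single b a 1) * Tser p hbar
        - Tser p hbar * PowerSeries.C (Matrix.single b a 1 * tMode p hbar m))) := by
  ext1 n
  rcases n with _ | n
  · have h0 : PowerSeries.constantCoeff (Tser p hbar) = 1 := constantCoeff_Tser p hbar
    simp [h0]
  · have h := koszulDiag_exchange p hbar a b m n
    simp only [tMode, mul_assoc] at h
    simpa only [map_sub, PowerSeries.coeff_succ_X_mul, PowerSeries.coeff_C_mul,
      PowerSeries.coeff_mul_C, PowerSeries.coeff_smul, tMode, mul_assoc] using h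

/-- Multiplying by `t'` on both sides turns each `y t - t z` into `t' y - z t'`. -/
theorem exchange_conj {R : Type*} [Ring R] [Algebra ℂ R] {t t' x : R} (h₁ : t * t' = 1)
    (h₂ : t' * t = 1) (hx : ∀ y, Commute x y) (k : ℂ) {a b c e : R}
    (h : x * (a * t - t * a) - (b * t - t * b) = k • (x * (c * t - t * e))) :
    x * (t' * a - a * t') - (t' * b - b * t') = k • (x * (t' * c - e * t')) := by
  have key : ∀ y z : R, t' * (y * t - t * z) * t' = t' * y - z * t' := by
    intro y z
    rw [mul_sub, sub_mul, ← mul_assoc, ← mul_assoc, h₂, one_mul, mul_assoc, h₁, mul_one]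
  replace h : t' * _ * t' = t' * _ * t' := congrArg (fun y => t' * y * t') h
  have hX : ∀ y : R, t' * (x * y) * t' = x * (t' * y * t') := by
    intro y
    rw [← mul_assoc, ← (hx t').eq, mul_assoc, mul_assoc, mul_assoc]
  rwa [mul_sub t' (x * _), sub_mul (t' * (x * _)), hX, key, key, mul_smul_comm, smul_mul_assoc, hX,
    key] at h

theorem koszulDiag_exchange_inv_series (a b : Fin d) (m : ℕ) :
    PowerSeries.X * (TserInv p hbar * PowerSeries.C (koszulDiag p hbar a b (m + 1))
        - PowerSeries.C (koszulDiag p hbar a b (m + 1)) * TserInv p hbar)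
      - (TserInv p hbar * PowerSeries.C (koszulDiag p hbar a b m)
        - PowerSeries.C (koszulDiag p hbar a b m) * TserInv p hbar) =
    (hbar * (-1) ^ ((p a : ℕ) * (p b : ℕ))) • (PowerSeries.X *
      (TserInv p hbar * PowerSeries.C (tMode p hbar m * Matrix.single b a 1)
        - PowerSeries.C (Matrix.single b a 1 * tMode p hbar m) * TserInv p hbar)) := by
  exact exchange_conj (Tser_mul_TserInv p hbar) (TserInv_mul_Tser p hbar)
    (fun y => (PowerSeries.commute_X y).symm) _ (koszulDiag_exchange_series p hbar a b m)

/-- The exchange relation between `T(u)` and `T⁻¹(v)`, in modes. -/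
theorem tInvMode_exchange (a b g f : Fin d) (m n : ℕ) :
    ((-1 : ℂ) ^ (((p a : ℕ) + (p b : ℕ)) * (p f : ℕ))) •
        (tInvMode p hbar n g f * tMode p hbar (m + 1) a b
          - tInvMode p hbar (n + 1) g f * tMode p hbar m a b)
      - ((-1 : ℂ) ^ (((p a : ℕ) + (p b : ℕ)) * (p g : ℕ))) •
        (tMode p hbar (m + 1) a b * tInvMode p hbar n g f
          - tMode p hbar m a b * tInvMode p hbar (n + 1) g f) =
    (hbar * (-1) ^ ((p a : ℕ) * (p b : ℕ))) •
      ((if a = f then ∑ c, tInvMode p hbar n g c * tMode p hbar m c b else 0)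
        - (if g = b then ∑ c, tMode p hbar m a c * tInvMode p hbar n c f else 0)) := by
  have h := congrArg (fun y : (Matrix (Fin d) (Fin d) (SuperYangian p))⟦X⟧ =>
    (PowerSeries.coeff (n + 1) y : Matrix _ _ _) g f)
    (koszulDiag_exchange_inv_series p hbar a b m)
  simp only [map_sub, PowerSeries.coeff_succ_X_mul, PowerSeries.coeff_C_mul,
      PowerSeries.coeff_mul_C, PowerSeries.coeff_smul, ← mul_assoc] at h
  have e1 : ∀ X : Matrix (Fin d) (Fin d) (SuperYangian p),
      (X * Matrix.single b a (1 : SuperYangian p) : Matrix _ _ _) g f =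
        if a = f then X g b else 0 := by
    intro X
    split_ifs with haf
    · subst haf; simp
    · exact (Matrix.mul_single_apply_of_ne _ _ _ _ _ (Ne.symm haf) _).trans rfl
  have e2 : ∀ X : Matrix (Fin d) (Fin d) (SuperYangian p),
      (Matrix.single b a (1 : SuperYangian p) * X : Matrix _ _ _) g f =
        if g = b then X a f else 0 := by
    intro X
    split_ifs with haf
    · subst haf; simp
    · exact (Matrix.single_mul_apply_of_ne _ _ _ _ _ haf _).trans rfl
  rw [mul_assoc (Matrix.single b a 1)] at h
  simp only [Matrix.sub_apply, Matrix.smul_apply, e1, e2, koszulDiag, Matrix.diagonal_mul,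
    Matrix.mul_diagonal, smul_mul_assoc, mul_smul_comm] at h
  simp only [Matrix.mul_apply] at h
  simp only [tInvMode, smul_sub] at h ⊢
  rw [← h]
  abel

end SuperYangian

/-! ### Highest weight vectors and the entries of `T⁻¹(u)` -/

theorem neg_one_pow_mul_self (n : ℕ) : (-1 : ℂ) ^ (n * n) = (-1) ^ n := by
  rcases Nat.even_or_odd n with h | h
  · rw [h.neg_one_pow, (h.mul_right n).neg_one_pow]
  · rw [h.neg_one_pow, (h.mul h).neg_one_pow]

/-- A double sequence whose increments along the antidiagonals lie in a submodule `W` lies in `W`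
if it does so on the boundary. -/
theorem mem_of_antidiagonal_increments {V : Type*} [AddCommGroup V] [Module ℂ V]
    (W : Submodule ℂ V) {A S : ℕ → ℕ → V} {c : ℂ} (h₀ : ∀ n, A 0 n ∈ W)
    (h : ∀ m n, A (m + 1) n - A m (n + 1) = c • S m n) {N : ℕ}
    (hS : ∀ m n, m + n < N → S m n ∈ W) : ∀ m n, m + n ≤ N → A m n ∈ W := by
  intro m
  induction m with
  | zero => exact fun n _ => h₀ n
  | succ m ih =>
    intro n hn
    -- One step along the antidiagonal towards `m = 0`; the source term has total degree one less.
    rw [sub_eq_iff_eq_add.mp (h m n)]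
    exact W.add_mem (W.smul_mem _ (hS m n (by omega))) (ih (n + 1) (by omega))

namespace SuperYangian

variable {d : ℕ} (p : Fin d → Fin 2) (hbar : ℂ)

theorem tInvMode_succ_apply (n : ℕ) (g f : Fin d) :
    tInvMode p hbar (n + 1) g f = -∑ q ∈ Finset.HasAntidiagonal.antidiagonal n, ∑ c,
      tMode p hbar (q.1 + 1) g c * tInvMode p hbar q.2 c f := by
  have h := sum_tMode_mul_tInvMode p hbar (n + 1)
  rw [Finset.Nat.antidiagonal_succ, Finset.sum_cons, Finset.sum_map, if_neg (Nat.succ_ne_zero n),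
    tMode_zero, one_mul] at h
  rw [eq_neg_of_add_eq_zero_left h, Matrix.neg_apply, Matrix.sum_apply]
  rfl

end SuperYangian

section

open SuperYangian

variable {d : ℕ} {p : Fin d → Fin 2} {V : Type*} [AddCommGroup V] [Module ℂ V]

/-- The orbit map `x ↦ ρ(x) v`. -/
def orbitMap (ρ : SuperYangian p →ₐ[ℂ] Module.End ℂ V) (v : V) : SuperYangian p →ₗ[ℂ] V where
  toFun x := ρ x v
  map_add' x y := by simp
  map_smul' c x := by simp

variable {ρ : SuperYangian p →ₐ[ℂ] Module.End ℂ V} {v : V}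

theorem orbitMap_mul (x y : SuperYangian p) : orbitMap ρ v (x * y) = ρ x (orbitMap ρ v y) := by
  simp [orbitMap]

theorem orbitMap_mul_of_eq_zero {x y : SuperYangian p} (h : orbitMap ρ v y = 0) :
    orbitMap ρ v (x * y) = 0 := by
  rw [orbitMap_mul, h, map_zero]

theorem orbitMap_one : orbitMap ρ v 1 = v := by
  simp [orbitMap]

theorem orbitMap_mul_mem_span {x y : SuperYangian p}
    (hx : orbitMap ρ v x ∈ Submodule.span ℂ {v}) (hy : orbitMap ρ v y ∈ Submodule.span ℂ {v}) :
    orbitMap ρ v (x * y) ∈ Submodule.span ℂ {v} := by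
  obtain ⟨c, hc⟩ := Submodule.mem_span_singleton.mp hy
  rw [orbitMap_mul, ← hc, map_smul]
  exact Submodule.smul_mem _ _ hx

variable {hbar : ℂ} {lam : Fin d → ℂ⟦X⟧}

/-- The exchange relation, applied to `v`, for `T'_{je}(v) T_{ej}(u)`, provided that `T'_{je}(v)`
kills the vector. -/
theorem orbitMap_tInvMode_mul_tMode_step {j e : Fin d}
    (h0 : ∀ n, orbitMap ρ v (tInvMode p hbar n j e) = 0) (m n : ℕ) :
    orbitMap ρ v (tInvMode p hbar n j e * tMode p hbar (m + 1) e j)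
      - orbitMap ρ v (tInvMode p hbar (n + 1) j e * tMode p hbar m e j) =
    (hbar * (-1) ^ (p e : ℕ)) •
      (∑ c, orbitMap ρ v (tInvMode p hbar n j c * tMode p hbar m c j)
        - ∑ c, orbitMap ρ v (tMode p hbar m e c * tInvMode p hbar n c e)) := by
  have h := congrArg (orbitMap ρ v) (tInvMode_exchange p hbar e j j e m n)
  have s1 : ((-1 : ℂ) ^ (((p e : ℕ) + (p j : ℕ)) * (p e : ℕ))) *
      (-1) ^ (((p e : ℕ) + (p j : ℕ)) * (p e : ℕ)) = 1 := by
    rw [← pow_add, ← two_mul, pow_mul]; simp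
  have s2 : ((-1 : ℂ) ^ (((p e : ℕ) + (p j : ℕ)) * (p e : ℕ))) *
      (hbar * (-1) ^ ((p e : ℕ) * (p j : ℕ))) = hbar * (-1) ^ (p e : ℕ) := by
    rw [mul_left_comm, ← pow_add, ← neg_one_pow_mul_self (p e)]
    have : ((p e : ℕ) + (p j : ℕ)) * (p e : ℕ) + (p e : ℕ) * (p j : ℕ) =
      2 * ((p e : ℕ) * (p j : ℕ)) + (p e : ℕ) * (p e : ℕ) := by ring
    rw [this, pow_add, pow_mul]; simp
  rw [map_sub, map_smul, map_smul, map_smul, map_sub, map_sub, map_sub,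
    orbitMap_mul_of_eq_zero (x := tMode p hbar _ e j) (h0 _),
    orbitMap_mul_of_eq_zero (x := tMode p hbar _ e j) (h0 _), sub_zero, smul_zero, sub_zero,
    if_pos rfl, if_pos rfl, map_sum, map_sum] at h
  replace h := congrArg (fun y => ((-1 : ℂ) ^ (((p e : ℕ) + (p j : ℕ)) * (p e : ℕ))) • y) h
  simpa only [smul_smul, s1, s2, one_smul] using h

namespace IsHighestWeightVector

theorem orbitMap_tMode_lower (hv : IsHighestWeightVector hbar ρ v lam) {a b : Fin d}
    (hab : b < a) (n : ℕ) :
    orbitMap ρ v (tMode p hbar n a b) = 0 :=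
  hv.lower a b hab n

theorem orbitMap_tMode_diag (hv : IsHighestWeightVector hbar ρ v lam) (a : Fin d) (n : ℕ) :
    orbitMap ρ v (tMode p hbar n a a) = PowerSeries.coeff n (lam a) • v :=
  hv.diag a n

/-- The exchange relation, applied to `v`, for `T_{kj}(u) T'_{jl}(v)` with `j < k`. -/
theorem orbitMap_tMode_mul_tInvMode_step (hv : IsHighestWeightVector hbar ρ v lam)
    {k j : Fin d} (hjk : j < k) (l : Fin d) (m n : ℕ) :
    orbitMap ρ v (tMode p hbar (m + 1) k j * tInvMode p hbar n j l)
      - orbitMap ρ v (tMode p hbar m k j * tInvMode p hbar (n + 1) j l) =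
    (hbar * (-1) ^ (p j : ℕ)) •
      (∑ c, orbitMap ρ v (tMode p hbar m k c * tInvMode p hbar n c l)
        - if k = l then ∑ c, orbitMap ρ v (tInvMode p hbar n j c * tMode p hbar m c j) else 0) := by
  have h := congrArg (orbitMap ρ v) (tInvMode_exchange p hbar k j j l m n)
  have s1 : ((-1 : ℂ) ^ (((p k : ℕ) + (p j : ℕ)) * (p j : ℕ))) *
      (-1) ^ (((p k : ℕ) + (p j : ℕ)) * (p j : ℕ)) = 1 := by
    rw [← pow_add, ← two_mul, pow_mul]; simp
  have s2 : ((-1 : ℂ) ^ (((p k : ℕ) + (p j : ℕ)) * (p j : ℕ))) *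
      (hbar * (-1) ^ ((p k : ℕ) * (p j : ℕ))) = hbar * (-1) ^ (p j : ℕ) := by
    rw [mul_left_comm, ← pow_add, ← neg_one_pow_mul_self (p j)]
    have : ((p k : ℕ) + (p j : ℕ)) * (p j : ℕ) + (p k : ℕ) * (p j : ℕ) =
      2 * ((p k : ℕ) * (p j : ℕ)) + (p j : ℕ) * (p j : ℕ) := by ring
    rw [this, pow_add, pow_mul]; simp
  rw [map_sub, map_smul, map_smul, map_smul, map_sub, map_sub, map_sub,
    orbitMap_mul_of_eq_zero (hv.orbitMap_tMode_lower hjk _),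
    orbitMap_mul_of_eq_zero (hv.orbitMap_tMode_lower hjk _), sub_zero, smul_zero, zero_sub,
    if_pos rfl] at h
  replace h := congrArg (fun y => ((-1 : ℂ) ^ (((p k : ℕ) + (p j : ℕ)) * (p j : ℕ))) • y) h
  simp only [smul_neg, smul_smul, s1, s2, one_smul] at h
  rw [neg_eq_iff_eq_neg.mp h, ← smul_neg, neg_sub, map_sum]
  split_ifs
  · rw [map_sum]
  · rw [map_zero]

/-- Products and entries of `T⁻¹` are handled together, by induction on the total degree. For `e <
g` the recursion along the antidiagonal applies. For `e ≥ g` the factor `T'_{ef}` already kills `v`,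
because `T T⁻¹ = 1` writes it through products that are already known to vanish. -/
theorem orbitMap_tMode_mul_tInvMode_lower (hv : IsHighestWeightVector hbar ρ v lam) (N : ℕ) :
    ∀ r s, r + s = N → ∀ g f : Fin d, f < g →
    ∀ e, orbitMap ρ v (tMode p hbar r g e * tInvMode p hbar s e f) = 0 := by
  induction N using Nat.strong_induction_on with
  | _ N ih =>
  have hstep : ∀ g f e : Fin d, f < g → e < g → ∀ r s, r + s ≤ N →
      orbitMap ρ v (tMode p hbar r g e * tInvMode p hbar s e f) = 0 := by
    intro g f e hfg heg r s hrs
    rw [← Submodule.mem_bot ℂ]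
    refine mem_of_antidiagonal_increments ⊥
      (A := fun r s => orbitMap ρ v (tMode p hbar r g e * tInvMode p hbar s e f)) ?_
      (fun m n => (hv.orbitMap_tMode_mul_tInvMode_step heg f m n)) ?_ r s hrs
    · intro n
      simp [tMode_zero, Matrix.one_apply_ne heg.ne']
    · intro m n hmn
      rw [if_neg hfg.ne', sub_zero]
      exact Submodule.sum_mem _ fun c _ => (Submodule.mem_bot ℂ).mpr (ih _ hmn m n rfl g f hfg c)
  have hinv : ∀ s, s ≤ N → ∀ g f : Fin d, f < g → orbitMap ρ v (tInvMode p hbar s g f) = 0 := by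
    intro s hs g f hfg
    rcases s with _ | s
    · simp [tInvMode_zero, Matrix.one_apply_ne hfg.ne']
    · rw [tInvMode_succ_apply, map_neg, map_sum, neg_eq_zero]
      refine Finset.sum_eq_zero fun q hq => ?_
      rw [Finset.HasAntidiagonal.mem_antidiagonal] at hq
      rw [map_sum]
      refine Finset.sum_eq_zero fun c _ => ?_
      rcases lt_or_ge c g with hc | hc
      · exact hstep g f c hfg hc _ _ (by omega)
      · apply orbitMap_mul_of_eq_zero
        have := ih q.2 (by omega) 0 q.2 (by omega) c f (hfg.trans_le hc) c
        simpa [tMode_zero] using this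
  intro r s hrs g f hfg e
  rcases lt_or_ge e g with he | he
  · exact hstep g f e hfg he r s hrs.le
  · exact orbitMap_mul_of_eq_zero (hinv s (by omega) e f (hfg.trans_le he))

theorem orbitMap_tInvMode_lower (hv : IsHighestWeightVector hbar ρ v lam) {g f : Fin d}
    (hfg : f < g) (s : ℕ) :
    orbitMap ρ v (tInvMode p hbar s g f) = 0 := by
  simpa [tMode_zero] using hv.orbitMap_tMode_mul_tInvMode_lower s 0 s (by omega) g f hfg g

/-- The two orders of multiplication must be treated simultaneously, since the recursion of each has
row sums of the other as a source. -/
theorem orbitMap_mem_span (hv : IsHighestWeightVector hbar ρ v lam) (N : ℕ) :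
    ∀ r s, r + s = N → ∀ k j : Fin d,
    orbitMap ρ v (tMode p hbar r k j * tInvMode p hbar s j k) ∈ Submodule.span ℂ {v} ∧
    orbitMap ρ v (tInvMode p hbar s k j * tMode p hbar r j k) ∈ Submodule.span ℂ {v} := by
  induction N using Nat.strong_induction_on with
  | _ N ih =>
  have hT : ∀ k r, orbitMap ρ v (tMode p hbar r k k) ∈ Submodule.span ℂ {v} := fun k r =>
    hv.orbitMap_tMode_diag k r ▸ Submodule.smul_mem _ _ (Submodule.mem_span_singleton_self v)
  have hstep : ∀ k j : Fin d, j < k → ∀ r s, r + s ≤ N →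
      orbitMap ρ v (tMode p hbar r k j * tInvMode p hbar s j k) ∈ Submodule.span ℂ {v} := by
    intro k j hjk
    refine mem_of_antidiagonal_increments _
      (A := fun r s => orbitMap ρ v (tMode p hbar r k j * tInvMode p hbar s j k)) ?_
      (fun m n => (hv.orbitMap_tMode_mul_tInvMode_step hjk k m n)) ?_
    · intro n
      simp [tMode_zero, Matrix.one_apply_ne hjk.ne']
    · intro m n hmn
      rw [if_pos rfl]
      exact Submodule.sub_mem _ (Submodule.sum_mem _ fun c _ => (ih _ hmn m n rfl k c).1)
        (Submodule.sum_mem _ fun c _ => (ih _ hmn m n rfl j c).2)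
  have hstep' : ∀ j e : Fin d, e < j → ∀ r s, r + s ≤ N →
      orbitMap ρ v (tInvMode p hbar s j e * tMode p hbar r e j) ∈ Submodule.span ℂ {v} := by
    intro j e hej
    refine mem_of_antidiagonal_increments _
      (A := fun r s => orbitMap ρ v (tInvMode p hbar s j e * tMode p hbar r e j)) ?_
      (fun m n => (orbitMap_tInvMode_mul_tMode_step
        (hv.orbitMap_tInvMode_lower hej) m n)) ?_
    · intro n
      simp [tMode_zero, Matrix.one_apply_ne hej.ne]
    · intro m n hmn
      exact Submodule.sub_mem _ (Submodule.sum_mem _ fun c _ => (ih _ hmn m n rfl j c).2)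
        (Submodule.sum_mem _ fun c _ => (ih _ hmn m n rfl e c).1)
  have hinv : ∀ s, s ≤ N → ∀ k : Fin d,
      orbitMap ρ v (tInvMode p hbar s k k) ∈ Submodule.span ℂ {v} := by
    intro s hs k
    rcases s with _ | s
    · simp [tInvMode_zero, orbitMap_one, Submodule.mem_span_singleton_self]
    · rw [tInvMode_succ_apply, map_neg, map_sum]
      refine Submodule.neg_mem _ (Submodule.sum_mem _ fun q hq => ?_)
      rw [Finset.HasAntidiagonal.mem_antidiagonal] at hq
      rw [map_sum]
      refine Submodule.sum_mem _ fun c _ => ?_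
      rcases lt_trichotomy c k with hc | rfl | hc
      · exact hstep k c hc _ _ (by omega)
      · refine orbitMap_mul_mem_span (hT _ _) ?_
        have := (ih q.2 (by omega) 0 q.2 (by omega) c c).1
        simpa [tMode_zero] using this
      · rw [orbitMap_mul_of_eq_zero (hv.orbitMap_tInvMode_lower hc _)]
        exact Submodule.zero_mem _
  intro r s hrs k j
  rcases lt_trichotomy j k with hj | rfl | hj
  · exact ⟨hstep k j hj r s hrs.le, hstep' k j hj r s hrs.le⟩
  · exact ⟨orbitMap_mul_mem_span (hT _ _) (hinv s (by omega) _),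
      orbitMap_mul_mem_span (hinv s (by omega) _) (hT _ _)⟩
  · rw [orbitMap_mul_of_eq_zero (hv.orbitMap_tInvMode_lower hj _),
      orbitMap_mul_of_eq_zero (hv.orbitMap_tMode_lower hj _)]
    exact ⟨Submodule.zero_mem _, Submodule.zero_mem _⟩

end IsHighestWeightVector

end

/-! ### Triangular linear systems over a field -/

section RationalIdentities

variable {F : Type*} [Field F] {d : ℕ} {x h : F} {s S Z m K B g : ℕ → F}

/-- Both families of sums agree, as they solve the same triangular system. -/
theorem triangular_system_unique
    (hy : ∀ k, x - h * ∑ j ∈ Finset.range k, s j ≠ 0)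
    (hS : ∀ k < d, x * S k = x * m k + h * ∑ j ∈ Finset.range k, s j * (S k - Z j))
    (hZ : ∀ k < d, x * Z k = x * m k + h * ∑ j ∈ Finset.range k, s j * (Z k - S j)) :
    ∀ k < d, S k = Z k := by
  intro k
  induction k using Nat.strong_induction_on with
  | _ k ih =>
  intro hk
  have e : ∑ j ∈ Finset.range k, s j * S j = ∑ j ∈ Finset.range k, s j * Z j :=
    Finset.sum_congr rfl fun j hj => by
      have := Finset.mem_range.mp hj
      rw [ih j this (this.trans hk)]
  have h1 := hS k hk
  have h2 := hZ k hk
  simp only [mul_sub, Finset.sum_sub_distrib, ← Finset.sum_mul] at h1 h2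
  -- Subtracting the two equations leaves `S k - Z k` times `x - h ∑ s j`, by the induction
  -- hypothesis.
  refine mul_left_cancel₀ (hy k) ?_
  linear_combination h1 - h2 + h * e

/-- The eigenvalues `B_k = ∑_{j ≤ k} K_j A_{kj}`, where `x A_{kj} = h s_j (S_k - S_j)` for `j < k`,
in closed form. -/
theorem triangular_system_solution (hx : x ≠ 0)
    (hy : ∀ k, x - h * ∑ j ∈ Finset.range k, s j ≠ 0)
    (hS : ∀ k < d, x * S k = x * m k + h * ∑ j ∈ Finset.range k, s j * (S k - S j))
    (hB : ∀ k < d, x * B k = x * (K k * m k) +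
      h * ∑ j ∈ Finset.range k, K j * (s j * (S k - S j)))
    (hg : ∀ k < d, x * g k = K k * (x - h * ∑ j ∈ Finset.range k, s j) +
      h * ∑ j ∈ Finset.range k, s j * K j) :
    ∀ k < d, B k = x / (x - h * ∑ j ∈ Finset.range k, s j) * g k * m k -
      ∑ j ∈ Finset.range k, g j * (s j * h * (x * m j /
        ((x - h * ∑ i ∈ Finset.range (j + 1), s i) * (x - h * ∑ i ∈ Finset.range j, s i)))) := by
  intro k
  induction k with
  | zero =>
    intro hk
    have h1 := hB 0 hk
    have h2 := hg 0 hk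
    simp only [Finset.range_zero, Finset.sum_empty, mul_zero, add_zero, sub_zero] at h1 h2 ⊢
    rw [mul_left_cancel₀ hx h1, div_self hx, mul_left_cancel₀ hx (h2.trans (mul_comm _ _))]
    ring
  | succ k ih =>
    intro hk
    have hk' : k < d := by omega
    have h1 := hB k hk'
    have h2 := hg k hk'
    have h3 := hS k hk'
    have h1' := hB (k + 1) hk
    have h2' := hg (k + 1) hk
    have h3' := hS (k + 1) hk
    have e := ih hk'
    have y0 := hy k
    have y1 := hy (k + 1)
    simp only [Finset.sum_range_succ, mul_sub, Finset.sum_sub_distrib, ← Finset.sum_mul,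
      ← mul_assoc] at h1 h2 h3 h1' h2' h3' y0 y1
    have comm : ∑ j ∈ Finset.range k, K j * s j = ∑ j ∈ Finset.range k, s j * K j :=
      Finset.sum_congr rfl fun j _ => mul_comm _ _
    rw [comm] at h1 h1'
    set c := ∑ j ∈ Finset.range k, s j
    -- The equations for `k` may be summed over `j ≤ k`, as the extra term contains `S k - S k = 0`.
    -- Subtraction then leaves only `S (k + 1) - S k`, which the system for `S` expresses through
    -- `m`. The definition of `g k` is likewise unchanged when `j = k` is included in both of its
    -- sums.
    have key : B (k + 1) = B k +
        (x * g (k + 1) * m (k + 1) - x * g k * m k) / (x - h * (c + s k)) := by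
      rw [← sub_eq_iff_eq_add', eq_div_iff y1]
      refine mul_left_cancel₀ hx ?_
      linear_combination (x - h * (c + s k)) * (h1' - h1) +
        h * (∑ j ∈ Finset.range k, s j * K j + s k * K k) * (h3' - h3) -
        x * m (k + 1) * h2' + x * m k * h2
    rw [Finset.sum_range_succ (fun j => g j * _), key, e, Finset.sum_range_succ s]
    -- Partial fractions: the two reciprocals differ by `s k * h` over the product of the
    -- denominators.
    have key' : x / (x - h * c) * g k * m k +
        (x * g (k + 1) * m (k + 1) - x * g k * m k) / (x - h * (c + s k)) +
        g k * (s k * h * (x * m k / ((x - h * (c + s k)) * (x - h * c)))) =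
        x / (x - h * (c + s k)) * g (k + 1) * m (k + 1) := by
      field_simp
      ring
    linear_combination key'

/-- Partial sums against the signs `θ_j`, which are `-1`, `1`, `-1` on three successive blocks. -/
theorem sum_range_mul_blockSign {L₁ L₂ : ℕ} (hL : L₁ ≤ L₂) (s : ℕ → F) (k : ℕ) :
    ∑ j ∈ Finset.range k, s j * (if j < L₁ then -1 else if j < L₂ then 1 else -1) =
      -∑ j ∈ Finset.range k, s j + 2 * (∑ j ∈ Finset.range (min k L₂), s j -
        ∑ j ∈ Finset.range (min k L₁), s j) := by
  induction k with
  | zero => simp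
  | succ k ih =>
    rw [Finset.sum_range_succ, ih, Finset.sum_range_succ s k]
    have e : ∀ L, ∑ j ∈ Finset.range (min (k + 1) L), s j =
        ∑ j ∈ Finset.range (min k L), s j + if k < L then s k else 0 := by
      intro L
      split_ifs with h
      · rw [min_eq_left (by omega : k + 1 ≤ L), min_eq_left h.le, Finset.sum_range_succ]
      · rw [min_eq_right (by omega : L ≤ k + 1), min_eq_right (by omega : L ≤ k), add_zero]
    rw [e, e]
    split_ifs <;> first | omega | ring

/-- The equation that defines `g_k` from `K`, solved on the three blocks. -/
theorem boundary_function_eq {L₁ L₂ : ℕ} (hL : L₁ ≤ L₂) (s : ℕ → F) (u xi h : F) (k : ℕ) :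
    2 * u * (if k < L₁ then xi - u
        else if k < L₂ then xi + u - h * ∑ j ∈ Finset.range L₁, s j
        else xi - u - (h * ∑ j ∈ Finset.range L₁, s j - h * ∑ j ∈ Finset.range L₂, s j)) =
      (u * (if k < L₁ then -1 else if k < L₂ then 1 else -1) + xi) *
        (2 * u - h * ∑ j ∈ Finset.range k, s j) +
      h * ∑ j ∈ Finset.range k, s j *
        (u * (if j < L₁ then -1 else if j < L₂ then 1 else -1) + xi) := by
  have e := sum_range_mul_blockSign hL s k
  have e' : ∑ j ∈ Finset.range k, s j *
        (u * (if j < L₁ then -1 else if j < L₂ then 1 else -1) + xi) =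
      u * ∑ j ∈ Finset.range k, s j * (if j < L₁ then -1 else if j < L₂ then 1 else -1) +
        xi * ∑ j ∈ Finset.range k, s j := by
    rw [Finset.mul_sum, Finset.mul_sum, ← Finset.sum_add_distrib]
    exact Finset.sum_congr rfl fun j _ => by ring
  rw [e', e]
  split_ifs with h1 h2
  · rw [min_eq_left h1.le, min_eq_left (by omega : k ≤ L₂)]; ring
  · rw [min_eq_right (by omega : L₁ ≤ k), min_eq_left h2.le]; ring
  · rw [min_eq_right (by omega : L₁ ≤ k), min_eq_right (by omega : L₂ ≤ k)]; ring

end RationalIdentities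

/-! ### Specialization of two-variable series to `w = -u` -/

/-- The power series in `u⁻¹` obtained from the double sequence of coefficients of `u^{-r} w^{-s}`
by setting `w = -u`. -/
def altDiag (f : ℕ → ℕ → ℂ) : ℂ⟦X⟧ :=
  PowerSeries.mk fun n => ∑ q ∈ Finset.HasAntidiagonal.antidiagonal n, (-1) ^ q.2 * f q.1 q.2

theorem coeff_altDiag (f : ℕ → ℕ → ℂ) (n : ℕ) : PowerSeries.coeff n (altDiag f) =
    ∑ q ∈ Finset.HasAntidiagonal.antidiagonal n, (-1) ^ q.2 * f q.1 q.2 :=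
  PowerSeries.coeff_mk _ _

theorem altDiag_zero : altDiag (fun _ _ => 0) = 0 := by
  ext n; simp [coeff_altDiag]

theorem altDiag_sub (f g : ℕ → ℕ → ℂ) :
    altDiag (fun r s => f r s - g r s) = altDiag f - altDiag g := by
  ext n; simp [coeff_altDiag, mul_sub]

theorem altDiag_sum {ι : Type*} (t : Finset ι) (f : ι → ℕ → ℕ → ℂ) :
    altDiag (fun r s => ∑ i ∈ t, f i r s) = ∑ i ∈ t, altDiag (f i) := by
  ext n
  simp only [coeff_altDiag, map_sum, Finset.mul_sum]
  exact Finset.sum_comm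

theorem altDiag_mul (f g : ℂ⟦X⟧) :
    altDiag (fun r s => PowerSeries.coeff r f * PowerSeries.coeff s g) = f * negVar g := by
  ext n
  rw [coeff_altDiag, PowerSeries.coeff_mul]
  refine Finset.sum_congr rfl fun q _ => ?_
  simp only [negVar, PowerSeries.coeff_mk]
  ring

/-- Multiplication by `u - w` becomes multiplication by `2u`. -/
theorem two_mul_altDiag {f g : ℕ → ℕ → ℂ} {c : ℂ} (h₀ : ∀ n, f 0 n = 0) (h₀' : ∀ n, f n 0 = 0)
    (h : ∀ m n, f (m + 1) n - f m (n + 1) = c * g m n) :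
    2 * altDiag f = PowerSeries.C c * (PowerSeries.X * altDiag g) := by
  ext n
  rw [two_mul, map_add, PowerSeries.coeff_C_mul]
  rcases n with _ | n
  · simp [coeff_altDiag, h₀]
  · rw [PowerSeries.coeff_succ_X_mul, coeff_altDiag, coeff_altDiag]
    -- One copy of the antidiagonal loses its end `(0, n + 1)` and the other its end `(n + 1, 0)`;
    -- the boundary hypotheses make both terms zero, and the remaining terms pair into increments.
    nth_rw 1 [Finset.Nat.antidiagonal_succ]
    rw [Finset.Nat.antidiagonal_succ', Finset.sum_cons, Finset.sum_cons, Finset.sum_map,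
      Finset.sum_map, h₀, h₀', mul_zero, mul_zero, zero_add, zero_add, ← Finset.sum_add_distrib,
      Finset.mul_sum]
    refine Finset.sum_congr rfl fun q _ => ?_
    have := h q.1 q.2
    change (-1) ^ q.2 * f (q.1 + 1) q.2 + (-1) ^ (q.2 + 1) * f q.1 (q.2 + 1) = _
    rw [pow_succ]
    linear_combination (-1) ^ q.2 * this

/-! ### Laurent series in `u⁻¹` -/

theorem toLaurent_mul {R : Type*} [Ring R] (f g : R⟦X⟧) :
    toLaurent (f * g) = toLaurent f * toLaurent g :=
  map_mul (HahnSeries.ofPowerSeries ℤ R) f g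

theorem toLaurent_C {R : Type*} [Ring R] (r : R) :
    toLaurent (PowerSeries.C r) = HahnSeries.C r :=
  HahnSeries.ofPowerSeries_C r

theorem coeff_toLaurent_natCast {R : Type*} [Ring R] (f : R⟦X⟧) (n : ℕ) :
    (toLaurent f).coeff (n : ℤ) = PowerSeries.coeff n f :=
  LaurentSeries.coeff_coe_powerSeries f n

theorem coeff_toLaurent_of_neg {R : Type*} [Ring R] (f : R⟦X⟧) {n : ℤ} (hn : n < 0) :
    (toLaurent f).coeff n = 0 := by
  rw [toLaurent, HahnSeries.ofPowerSeries_apply]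
  refine HahnSeries.embDomain_of_notMem_range ?_
  rintro ⟨m, hm⟩
  have : (m : ℤ) = n := hm
  omega

theorem coeff_uVar_mul {R : Type*} [Ring R] (f : LaurentSeries R) (n : ℤ) :
    (uVar R * f).coeff n = f.coeff (n + 1) := by
  have := HahnSeries.coeff_single_mul_add (r := (1 : R)) (x := f) (a := n + 1) (b := -1)
  rwa [add_neg_cancel_right, one_mul] at this

theorem coeff_mul_uVar {R : Type*} [Ring R] (f : LaurentSeries R) (n : ℤ) :
    (f * uVar R).coeff n = f.coeff (n + 1) := by
  have := HahnSeries.coeff_mul_single_add (r := (1 : R)) (x := f) (a := n + 1) (b := -1)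
  rwa [add_neg_cancel_right, mul_one] at this

theorem uVar_commute {R : Type*} [Ring R] (f : LaurentSeries R) : uVar R * f = f * uVar R := by
  ext n
  rw [coeff_uVar_mul, coeff_mul_uVar]

theorem uVar_mul_toLaurent_X : uVar ℂ * toLaurent PowerSeries.X = 1 := by
  rw [toLaurent, HahnSeries.ofPowerSeries_X, uVar, HahnSeries.single_mul_single]
  simp

theorem two_mul_uVar_sub_C_ne_zero (c : ℂ) : 2 * uVar ℂ - HahnSeries.C c ≠ 0 := by
  intro h
  have := congrArg (fun f : LaurentSeries ℂ => f.coeff (-1)) h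
  simp [two_mul, uVar, HahnSeries.C_apply] at this

theorem two_mul_uVar_ne_zero : 2 * uVar ℂ ≠ 0 := by
  simpa using two_mul_uVar_sub_C_ne_zero 0

theorem two_mul_uVar_mul_toLaurent_altDiag {f g : ℕ → ℕ → ℂ} {c : ℂ} (h₀ : ∀ n, f 0 n = 0)
    (h₀' : ∀ n, f n 0 = 0) (h : ∀ m n, f (m + 1) n - f m (n + 1) = c * g m n) :
    2 * uVar ℂ * toLaurent (altDiag f) = HahnSeries.C c * toLaurent (altDiag g) := by
  have e := congrArg toLaurent (two_mul_altDiag h₀ h₀' h)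
  rw [toLaurent_mul, toLaurent_mul, toLaurent_mul, toLaurent_C] at e
  have e2 : toLaurent (2 : ℂ⟦X⟧) = 2 := map_ofNat (HahnSeries.ofPowerSeries ℤ ℂ) 2
  rw [e2] at e
  linear_combination uVar ℂ * e +
    HahnSeries.C c * toLaurent (altDiag g) * uVar_mul_toLaurent_X

/-! ### The entries of `B(u)` on a highest weight vector -/

section

open SuperYangian

variable {d : ℕ} {p : Fin d → Fin 2}

/-- Since `u` is central, the only non-negative power of `u` outside the power series can be pulled
to the front. -/
theorem Bmat_eq (hbar xi : ℂ) (L₁ L₂ : ℕ) : Bmat p hbar xi L₁ L₂ =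
    uVar _ * toLaurent (Tser p hbar * PowerSeries.C (Matrix.diagonal fun i =>
        algebraMap ℂ (SuperYangian p) (thetaSign L₁ L₂ i)) * negVar (TserInv p hbar)) +
      toLaurent (Tser p hbar * PowerSeries.C (Matrix.diagonal fun _ =>
        algebraMap ℂ (SuperYangian p) xi) * negVar (TserInv p hbar)) := by
  rw [Bmat, Kmat, mul_add, add_mul, toLaurent_mul, toLaurent_mul, toLaurent_mul, toLaurent_mul,
    toLaurent_C, toLaurent_C, ← mul_assoc, ← mul_assoc, ← mul_assoc, uVar_commute]

theorem coeff_T_mul_diagonal_mul_TInv (hbar : ℂ) (c : Fin d → ℂ) (n : ℕ) (k l : Fin d) :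
    (PowerSeries.coeff n (Tser p hbar * PowerSeries.C (Matrix.diagonal fun i =>
        algebraMap ℂ (SuperYangian p) (c i)) * negVar (TserInv p hbar)) :
        Matrix (Fin d) (Fin d) (SuperYangian p)) k l =
      ∑ j, c j • ∑ q ∈ Finset.HasAntidiagonal.antidiagonal n,
        (-1 : ℂ) ^ q.2 • (tMode p hbar q.1 k j * tInvMode p hbar q.2 j l) := by
  rw [PowerSeries.coeff_mul, Matrix.sum_apply]
  simp only [PowerSeries.coeff_mul_C, negVar, PowerSeries.coeff_mk, Finset.smul_sum]
  rw [Finset.sum_comm]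
  refine Finset.sum_congr rfl fun q _ => ?_
  have e : ((-1) ^ q.2 * PowerSeries.coeff q.2 (TserInv p hbar) :
      Matrix (Fin d) (Fin d) (SuperYangian p)) = (-1 : ℂ) ^ q.2 • tInvMode p hbar q.2 := by
    rcases neg_one_pow_eq_or ℂ q.2 with h | h <;>
    rcases Nat.even_or_odd q.2 with h' | h' <;> simp [h'.neg_one_pow, tInvMode]
  rw [e, Matrix.mul_smul, Matrix.smul_apply, Matrix.mul_apply, Finset.smul_sum]
  refine Finset.sum_congr rfl fun j _ => ?_
  rw [Matrix.mul_diagonal, ← Algebra.commutes, ← Algebra.smul_def, smul_mul_assoc, smul_comm]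
  rfl

variable {V : Type*} [AddCommGroup V] [Module ℂ V]
  {ρ : SuperYangian p →ₐ[ℂ] Module.End ℂ V} {v : V} {hbar : ℂ}

/-- If the products `T_{kj}^{(r)} T'_{jl}^{(s)}` act on `v` by the scalars `f_j(r, s)`, then
`B_{kl}(u)` acts by the corresponding series. -/
theorem orbitMap_coeff_Bmat (xi : ℂ) (L₁ L₂ : ℕ) {k l : Fin d} {f : Fin d → ℕ → ℕ → ℂ}
    (hf : ∀ j r s, orbitMap ρ v (tMode p hbar r k j * tInvMode p hbar s j l) = f j r s • v)
    (n : ℤ) :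
    orbitMap ρ v ((Bmat p hbar xi L₁ L₂).coeff n k l) =
      (∑ j, (uVar ℂ * HahnSeries.C (thetaSign L₁ L₂ j) + HahnSeries.C xi) *
        toLaurent (altDiag (f j))).coeff n • v := by
  have aux : ∀ (c : Fin d → ℂ) (n : ℤ),
      orbitMap ρ v ((toLaurent (Tser p hbar * PowerSeries.C (Matrix.diagonal fun i =>
        algebraMap ℂ (SuperYangian p) (c i)) * negVar (TserInv p hbar))).coeff n k l) =
      (toLaurent (∑ j, PowerSeries.C (c j) * altDiag (f j))).coeff n • v := by
    intro c n
    rcases lt_or_ge n 0 with hn | hn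
    · rw [coeff_toLaurent_of_neg _ hn, coeff_toLaurent_of_neg _ hn, Matrix.zero_apply, map_zero,
        zero_smul]
    · lift n to ℕ using hn
      rw [coeff_toLaurent_natCast, coeff_toLaurent_natCast, coeff_T_mul_diagonal_mul_TInv, map_sum,
        map_sum, Finset.sum_smul]
      refine Finset.sum_congr rfl fun j _ => ?_
      rw [map_smul, map_sum, PowerSeries.coeff_C_mul, mul_smul, coeff_altDiag, Finset.sum_smul]
      simp only [map_smul, hf, mul_smul]
  have hsum : ∀ g : Fin d → ℂ⟦X⟧, toLaurent (∑ j, g j) = ∑ j, toLaurent (g j) := fun g =>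
    map_sum (HahnSeries.ofPowerSeries ℤ ℂ) g _
  have e : ∑ j, (uVar ℂ * HahnSeries.C (thetaSign L₁ L₂ j) + HahnSeries.C xi) *
        toLaurent (altDiag (f j)) =
      uVar ℂ * toLaurent (∑ j, PowerSeries.C (thetaSign L₁ L₂ j) * altDiag (f j)) +
        toLaurent (∑ j, PowerSeries.C xi * altDiag (f j)) := by
    rw [hsum, hsum, Finset.mul_sum, ← Finset.sum_add_distrib]
    refine Finset.sum_congr rfl fun j _ => ?_
    rw [toLaurent_mul, toLaurent_mul, toLaurent_C, toLaurent_C]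
    ring
  rw [e, Bmat_eq, HahnSeries.coeff_add, HahnSeries.coeff_add, coeff_uVar_mul, coeff_uVar_mul,
    Matrix.add_apply, map_add, aux, aux, add_smul]

end

/-! ### Row sums of coupled triangular arrays -/

section

theorem Fin.sum_Iio_val {M : Type*} [AddCommMonoid M] {d : ℕ} (k : Fin d) (f : ℕ → M) :
    ∑ j ∈ Finset.Iio k, f j = ∑ j ∈ Finset.range k, f j := by
  have e : Finset.range (k : ℕ) = (Finset.Iio k).map Fin.valEmbedding := by
    rw [Fin.map_valEmbedding_Iio, Nat.Iio_eq_range]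
  rw [e, Finset.sum_map]
  rfl

variable {F : Type*} [Field F] {d : ℕ} {x h : F}

theorem Fin.mul_sum_of_upper_eq_zero {f : Fin d → F} {G : ℕ → F} {k : Fin d}
    (h₀ : ∀ j, k < j → f j = 0) (h₁ : ∀ j, j < k → x * f j = G j) :
    x * ∑ j, f j = x * f k + ∑ j ∈ Finset.range k, G j := by
  have e : ∑ j, f j = f k + ∑ j ∈ Finset.Iio k, f j := by
    rw [← Finset.sum_insert Finset.notMem_Iio_self, Finset.Iio_insert]
    refine (Finset.sum_subset (Finset.subset_univ _) fun j _ hj => h₀ j ?_).symm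
    simpa using hj
  rw [e, mul_add, Finset.mul_sum, ← Fin.sum_Iio_val k G]
  exact congrArg _ (Finset.sum_congr rfl fun j hj => h₁ j (Finset.mem_Iio.mp hj))

/-- The weighted row sums of two coupled triangular arrays, in closed form. -/
theorem coupled_triangular_arrays {s m K g : ℕ → F} {a b : Fin d → Fin d → F} (hx : x ≠ 0)
    (hy : ∀ k, x - h * ∑ j ∈ Finset.range k, s j ≠ 0)
    (ha_diag : ∀ k, a k k = m k) (hb_diag : ∀ k, b k k = m k)
    (ha_upper : ∀ k j, k < j → a k j = 0) (hb_upper : ∀ k j, k < j → b k j = 0)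
    (ha : ∀ k j, j < k → x * a k j = h * s j * (∑ c, a k c - ∑ c, b j c))
    (hb : ∀ k j, j < k → x * b k j = h * s j * (∑ c, b k c - ∑ c, a j c))
    (hg : ∀ k < d, x * g k = K k * (x - h * ∑ j ∈ Finset.range k, s j) +
      h * ∑ j ∈ Finset.range k, s j * K j) (k : Fin d) :
    ∑ j : Fin d, K j * a k j = x / (x - h * ∑ j ∈ Finset.range k, s j) * g k * m k -
      ∑ j ∈ Finset.Iio k, g j * (s j * h * (x * m j /
        ((x - h * ∑ i ∈ Finset.range (j + 1), s i) * (x - h * ∑ i ∈ Finset.range j, s i)))) := by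
  -- Extension by zero to all of `ℕ` allows induction over `Finset.range`; only the values below `d`
  -- matter.
  set S : ℕ → F := Function.extend Fin.val (fun k => ∑ c, a k c) 0 with hSdef
  set Z : ℕ → F := Function.extend Fin.val (fun k => ∑ c, b k c) 0 with hZdef
  set B : ℕ → F := Function.extend Fin.val (fun k : Fin d => ∑ j : Fin d, K j * a k j) 0 with hBdef
  have eS : ∀ k : Fin d, S k = ∑ c, a k c := Fin.val_injective.extend_apply _ _
  have eZ : ∀ k : Fin d, Z k = ∑ c, b k c := Fin.val_injective.extend_apply _ _
  have eB : ∀ k : Fin d, B k = ∑ j : Fin d, K j * a k j := Fin.val_injective.extend_apply _ _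
  simp only [← eS, ← eZ] at ha hb
  have hS : ∀ k < d, x * S k = x * m k + h * ∑ j ∈ Finset.range k, s j * (S k - Z j) := by
    intro k hk
    have := Fin.mul_sum_of_upper_eq_zero (k := ⟨k, hk⟩) (x := x)
      (G := fun j => h * (s j * (S k - Z j))) (ha_upper ⟨k, hk⟩)
      (fun j hj => (ha _ j hj).trans (mul_assoc _ _ _))
    rwa [← eS, ha_diag, ← Finset.mul_sum] at this
  have hZ : ∀ k < d, x * Z k = x * m k + h * ∑ j ∈ Finset.range k, s j * (Z k - S j) := by
    intro k hk
    have := Fin.mul_sum_of_upper_eq_zero (k := ⟨k, hk⟩) (x := x)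
      (G := fun j => h * (s j * (Z k - S j))) (hb_upper ⟨k, hk⟩)
      (fun j hj => (hb _ j hj).trans (mul_assoc _ _ _))
    rwa [← eZ, hb_diag, ← Finset.mul_sum] at this
  have hSZ := triangular_system_unique hy hS hZ
  have hS' : ∀ k < d, x * S k = x * m k + h * ∑ j ∈ Finset.range k, s j * (S k - S j) := by
    intro k hk
    rw [hS k hk]
    congr 2
    refine Finset.sum_congr rfl fun j hj => ?_
    rw [hSZ j ((Finset.mem_range.mp hj).trans hk)]
  have hB : ∀ k < d, x * B k = x * (K k * m k) +
      h * ∑ j ∈ Finset.range k, K j * (s j * (S k - S j)) := by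
    intro k hk
    have := Fin.mul_sum_of_upper_eq_zero (k := ⟨k, hk⟩) (x := x)
      (f := fun j => K j * a ⟨k, hk⟩ j)
      (G := fun j => h * (K j * (s j * (S k - S j))))
      (fun j hj => by rw [ha_upper _ j hj, mul_zero])
      (fun j hj => by
        have := ha _ j hj
        rw [hSZ j j.2]
        linear_combination K j * this)
    rwa [← eB, ha_diag, ← Finset.mul_sum] at this
  rw [← eB]
  refine (triangular_system_solution hx hy hS' hB hg k k.2).trans (congrArg _ ?_)
  exact (Fin.sum_Iio_val k _).symm

end

/-! ### From the action on the highest weight vector to the eigenvalues of `B(u)` -/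

section

variable {d : ℕ} {p : Fin d → Fin 2}

/-- The sign `(-1)^{[a]}` as a function on all natural numbers, zero outside the index range. -/
def gradeSign (p : Fin d → Fin 2) : ℕ → ℂ :=
  Function.extend Fin.val (fun a : Fin d => (-1) ^ (p a : ℕ)) 0

theorem gradeSign_val (a : Fin d) : gradeSign p a = (-1) ^ (p a : ℕ) :=
  Fin.val_injective.extend_apply _ _ a

theorem cInt_eq_sum_range {k : ℕ} (hk : k ≤ d) :
    (cInt p k : ℂ) = ∑ j ∈ Finset.range k, gradeSign p j := by
  have e : (cInt p k : ℂ) = ∑ a : Fin d, if (a : ℕ) < k then gradeSign p a else 0 := by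
    rw [cInt, Int.cast_sum]
    refine Finset.sum_congr rfl fun a _ => ?_
    split_ifs <;> simp [gradeSign_val]
  rw [e, Fin.sum_univ_eq_sum_range (fun i => if i < k then gradeSign p i else 0),
    ← Finset.sum_filter]
  congr 1
  ext i
  simp only [Finset.mem_filter, Finset.mem_range]
  omega

theorem hc_eq (hbar : ℂ) {k : ℕ} (hk : k ≤ d) :
    hc p hbar k = HahnSeries.C hbar *
      ∑ j ∈ Finset.range k, (HahnSeries.C (gradeSign p j) : LaurentSeries ℂ) := by
  rw [hc, cInt_eq_sum_range hk, map_mul, map_sum]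

/-- The scalars by which the products of entries of `T(u)` and `T⁻¹(w)` act on a highest weight
vector determine the eigenvalues of `B(u)`. -/
theorem sum_boundary_mul_eq_BEigenvalue {hbar xi : ℂ} {L₁ L₂ : ℕ} (hL : L₁ ≤ L₂) (hL₂ : L₂ ≤ d)
    {lam lam' : Fin d → ℂ⟦X⟧} {A C : Fin d → Fin d → ℕ → ℕ → ℂ}
    (hA_diag : ∀ k r s, A k k r s = PowerSeries.coeff r (lam k) * PowerSeries.coeff s (lam' k))
    (hC_diag : ∀ k r s, C k k r s = PowerSeries.coeff r (lam k) * PowerSeries.coeff s (lam' k))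
    (hA_upper : ∀ k j, k < j → ∀ r s, A k j r s = 0)
    (hC_upper : ∀ k j, k < j → ∀ r s, C k j r s = 0)
    (hA_left : ∀ k j, j < k → ∀ n, A k j 0 n = 0) (hA_right : ∀ k j, j < k → ∀ n, A k j n 0 = 0)
    (hC_left : ∀ k j, j < k → ∀ n, C k j 0 n = 0) (hC_right : ∀ k j, j < k → ∀ n, C k j n 0 = 0)
    (hA : ∀ k j, j < k → ∀ m n, A k j (m + 1) n - A k j m (n + 1) =
      hbar * (-1) ^ (p j : ℕ) * (∑ c, A k c m n - ∑ c, C j c m n))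
    (hC : ∀ k j, j < k → ∀ m n, C k j (m + 1) n - C k j m (n + 1) =
      hbar * (-1) ^ (p j : ℕ) * (∑ c, C k c m n - ∑ c, A j c m n)) (k : Fin d) :
    ∑ j, (uVar ℂ * HahnSeries.C (thetaSign L₁ L₂ j) + HahnSeries.C xi) *
      toLaurent (altDiag (A k j)) = BEigenvalue p hbar xi L₁ L₂ lam lam' k := by
  have hsum : ∀ g : Fin d → ℂ⟦X⟧, toLaurent (∑ j, g j) = ∑ j, toLaurent (g j) := fun g =>
    map_sum (HahnSeries.ofPowerSeries ℤ ℂ) g _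
  have hsub : ∀ f g : ℂ⟦X⟧, toLaurent (f - g) = toLaurent f - toLaurent g := fun f g =>
    map_sub (HahnSeries.ofPowerSeries ℤ ℂ) f g
  have hzero : toLaurent (0 : ℂ⟦X⟧) = 0 := map_zero (HahnSeries.ofPowerSeries ℤ ℂ)
  set s : ℕ → LaurentSeries ℂ := fun j => HahnSeries.C (gradeSign p j) with hs
  set m : ℕ → LaurentSeries ℂ :=
    Function.extend Fin.val (fun k => toLaurent (lam k) * toLaurent (negVar (lam' k))) 0 with hm
  have em : ∀ k : Fin d, m k = toLaurent (lam k) * toLaurent (negVar (lam' k)) :=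
    Fin.val_injective.extend_apply _ _
  have diag : ∀ (f : ℕ → ℕ → ℂ) (k : Fin d),
      (∀ r s, f r s = PowerSeries.coeff r (lam k) * PowerSeries.coeff s (lam' k)) →
      toLaurent (altDiag f) = m k := by
    intro f k hf
    rw [em, ← toLaurent_mul, ← altDiag_mul]
    congr 2
    ext r s
    exact hf r s
  have upper : ∀ f : ℕ → ℕ → ℂ, (∀ r s, f r s = 0) → toLaurent (altDiag f) = 0 := by
    intro f hf
    have : f = fun _ _ => 0 := by
      ext r s
      exact hf r s
    rw [this, altDiag_zero, hzero]
  have step : ∀ (D E : Fin d → Fin d → ℕ → ℕ → ℂ) (k j : Fin d), (∀ n, D k j 0 n = 0) →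
      (∀ n, D k j n 0 = 0) →
      (∀ m n, D k j (m + 1) n - D k j m (n + 1) =
        hbar * (-1) ^ (p j : ℕ) * (∑ c, D k c m n - ∑ c, E j c m n)) →
      2 * uVar ℂ * toLaurent (altDiag (D k j)) = HahnSeries.C hbar * s j *
        (∑ c, toLaurent (altDiag (D k c)) - ∑ c, toLaurent (altDiag (E j c))) := by
    intro D E k j h₀ h₀' h
    rw [two_mul_uVar_mul_toLaurent_altDiag h₀ h₀'
      (g := fun m n => ∑ c, D k c m n - ∑ c, E j c m n) h, altDiag_sub, altDiag_sum, altDiag_sum,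
      hsub, hsum, hsum, map_mul, hs]
    simp only [gradeSign_val]
  have hy : ∀ k, 2 * uVar ℂ - HahnSeries.C hbar * ∑ j ∈ Finset.range k, s j ≠ 0 := by
    intro k
    rw [hs, ← map_sum, ← map_mul]
    exact two_mul_uVar_sub_C_ne_zero _
  have main := coupled_triangular_arrays (s := s) (m := m)
    (K := fun j => uVar ℂ * (if j < L₁ then -1 else if j < L₂ then 1 else -1) + HahnSeries.C xi)
    two_mul_uVar_ne_zero hy
    (fun k => diag (A k k) k (hA_diag k)) (fun k => diag (C k k) k (hC_diag k))
    (fun k j hkj => upper _ (hA_upper k j hkj)) (fun k j hkj => upper _ (hC_upper k j hkj))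
    (fun k j hjk => step A C k j (hA_left k j hjk) (hA_right k j hjk) (hA k j hjk))
    (fun k j hjk => step C A k j (hC_left k j hjk) (hC_right k j hjk) (hC k j hjk))
    (fun k _ => boundary_function_eq hL s (uVar ℂ) (HahnSeries.C xi) (HahnSeries.C hbar) k) k
  have eθ : ∀ j : Fin d, HahnSeries.C (thetaSign L₁ L₂ j) =
      (if (j : ℕ) < L₁ then -1 else if (j : ℕ) < L₂ then 1 else -1 : LaurentSeries ℂ) := by
    intro j
    rw [thetaSign]
    split_ifs <;> simp
  have eg : ∀ j : Fin d, gFun p hbar xi L₁ L₂ j =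
      if (j : ℕ) < L₁ then HahnSeries.C xi - uVar ℂ
        else if (j : ℕ) < L₂ then
          HahnSeries.C xi + uVar ℂ - HahnSeries.C hbar * ∑ j ∈ Finset.range L₁, s j
        else HahnSeries.C xi - uVar ℂ - (HahnSeries.C hbar * ∑ j ∈ Finset.range L₁, s j -
          HahnSeries.C hbar * ∑ j ∈ Finset.range L₂, s j) := by
    intro j
    rw [gFun, hc_eq hbar hL₂, hc_eq hbar (hL.trans hL₂)]
  have e₁ : 2 * uVar ℂ / (2 * uVar ℂ - HahnSeries.C hbar * ∑ j ∈ Finset.range k, s j) *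
      gFun p hbar xi L₁ L₂ k * m k =
      2 * uVar ℂ / (2 * uVar ℂ - hc p hbar k) * gFun p hbar xi L₁ L₂ k *
        toLaurent (lam k) * toLaurent (negVar (lam' k)) := by
    rw [hc_eq hbar k.2.le, em, mul_assoc _ (toLaurent (lam k))]
  have e₂ : ∀ j : Fin d, s j * HahnSeries.C hbar * (2 * uVar ℂ * m j /
      ((2 * uVar ℂ - HahnSeries.C hbar * ∑ i ∈ Finset.range (j + 1), s i) *
        (2 * uVar ℂ - HahnSeries.C hbar * ∑ i ∈ Finset.range j, s i))) =
      aFun p hbar lam lam' j := by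
    intro j
    rw [aFun, em, hc_eq hbar j.2.le, hc_eq hbar (Nat.succ_le_of_lt j.2), map_mul,
      ← gradeSign_val, mul_assoc (2 * uVar ℂ)]
  simp only [← eg, e₂] at main
  rw [e₁] at main
  simp only [eθ]
  exact main

end

/-! ### Proof of the main theorem -/

theorem exists_dual_apply_eq_one {V : Type*} [AddCommGroup V] [Module ℂ V] {v : V} (hv : v ≠ 0) :
    ∃ φ : V →ₗ[ℂ] ℂ, φ v = 1 := by
  obtain ⟨f, hf⟩ : ∃ f : Module.Dual ℂ V, f v ≠ 0 := by
    by_contra! h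
    exact hv ((Module.forall_dual_apply_eq_zero_iff ℂ v).mp h)
  exact ⟨(f v)⁻¹ • f, by simp [hf]⟩

end

theorem mainTheorem4 (M N : ℕ) (p : Fin (M + N) → Fin 2)
    (hp : (Finset.univ.filter fun a => p a = 0).card = M)
    (hbar xi : ℂ) (hhbar : hbar ≠ 0) (L₁ L₂ : ℕ) (hL : L₁ ≤ L₂) (hL₂ : L₂ ≤ M + N)
    {V : Type*} [AddCommGroup V] [Module ℂ V]
    (ρ : SuperYangian p →ₐ[ℂ] Module.End ℂ V) (v : V) (lam : Fin (M + N) → PowerSeries ℂ)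
    (hv : IsHighestWeightVector hbar ρ v lam) :
    -- `lam'` is the family of eigenvalues `λ'_k(u)` of the `T'_{kk}(u)` on `v`; as `v ≠ 0` it is unique
    ∃ lam' : Fin (M + N) → PowerSeries ℂ,
      (∀ k n, ρ (PowerSeries.coeff n (SuperYangian.TserInv p hbar) k k) v =
        PowerSeries.coeff n (lam' k) • v) ∧
      (∀ k l, l < k → ∀ n : ℤ,
        (ρ.comp (reflectionSuperalgebra p hbar xi L₁ L₂).val) (Bgen p hbar xi L₁ L₂ n k l) v = 0) ∧
      (∀ k, ∀ n : ℤ,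
        (ρ.comp (reflectionSuperalgebra p hbar xi L₁ L₂).val) (Bgen p hbar xi L₁ L₂ n k k) v =
          (BEigenvalue p hbar xi L₁ L₂ lam lam' k).coeff n • v) := by
  -- A functional with `φ v = 1` reads off the scalar from any multiple of `v`, so all recursions on
  -- `v` become recursions of complex numbers.
  obtain ⟨φ, hφ⟩ := exists_dual_apply_eq_one hv.ne_zero
  have span_eq : ∀ y ∈ Submodule.span ℂ {v}, y = φ y • v := by
    intro y hy
    obtain ⟨c, rfl⟩ := Submodule.mem_span_singleton.mp hy
    simp [hφ]
  have hinv : ∀ k n, orbitMap ρ v (SuperYangian.tInvMode p hbar n k k) =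
      φ (orbitMap ρ v (SuperYangian.tInvMode p hbar n k k)) • v := by
    intro k n
    refine span_eq _ ?_
    simpa [SuperYangian.tMode_zero] using (hv.orbitMap_mem_span n 0 n (zero_add n) k k).1
  have hmem := fun r s k j => hv.orbitMap_mem_span (r + s) r s rfl k j
  refine ⟨fun k => PowerSeries.mk fun n => φ (orbitMap ρ v (SuperYangian.tInvMode p hbar n k k)),
    ?_, ?_, ?_⟩
  · intro k n
    rw [PowerSeries.coeff_mk]
    exact hinv k n
  · intro k l hlk n
    refine (orbitMap_coeff_Bmat xi L₁ L₂ (f := fun _ _ _ => 0) (fun j r s => ?_) n).trans ?_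
    · rw [hv.orbitMap_tMode_mul_tInvMode_lower (r + s) r s rfl k l hlk j, zero_smul]
    · have hzero : toLaurent (0 : PowerSeries ℂ) = 0 := map_zero (HahnSeries.ofPowerSeries ℤ ℂ)
      simp [altDiag_zero, hzero]
  · intro k n
    refine (orbitMap_coeff_Bmat xi L₁ L₂
      (f := fun j r s =>
        φ (orbitMap ρ v (SuperYangian.tMode p hbar r k j * SuperYangian.tInvMode p hbar s j k)))
      (fun j r s => span_eq _ (hmem r s k j).1) n).trans ?_
    congr 2
    refine sum_boundary_mul_eq_BEigenvalue hL hL₂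
      (A := fun k j r s =>
        φ (orbitMap ρ v (SuperYangian.tMode p hbar r k j * SuperYangian.tInvMode p hbar s j k)))
      (C := fun k j r s =>
        φ (orbitMap ρ v (SuperYangian.tInvMode p hbar s k j * SuperYangian.tMode p hbar r j k)))
      ?_ ?_ ?_ ?_ ?_ ?_ ?_ ?_ ?_ ?_ k
    · intro k r s
      rw [orbitMap_mul, hinv, map_smul, map_smul]
      change _ * φ (orbitMap ρ v _) = _
      rw [hv.orbitMap_tMode_diag, map_smul, hφ, PowerSeries.coeff_mk, smul_eq_mul, mul_one,
        mul_comm]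
    · intro k r s
      rw [orbitMap_mul, hv.orbitMap_tMode_diag, map_smul, map_smul, PowerSeries.coeff_mk]
      rfl
    · intro k j hkj r s
      rw [orbitMap_mul_of_eq_zero (hv.orbitMap_tInvMode_lower hkj s), map_zero]
    · intro k j hkj r s
      rw [orbitMap_mul_of_eq_zero (hv.orbitMap_tMode_lower hkj r), map_zero]
    · intro k j hjk n
      simp [SuperYangian.tMode_zero, Matrix.one_apply_ne hjk.ne']
    · intro k j hjk n
      simp [SuperYangian.tInvMode_zero, Matrix.one_apply_ne hjk.ne]
    · intro k j hjk n
      simp [SuperYangian.tMode_zero, Matrix.one_apply_ne hjk.ne]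
    · intro k j hjk n
      simp [SuperYangian.tInvMode_zero, Matrix.one_apply_ne hjk.ne']
    · intro k j hjk m n
      have := congrArg φ (hv.orbitMap_tMode_mul_tInvMode_step hjk k m n)
      simpa using this
    · intro k j hjk m n
      have := congrArg φ (orbitMap_tInvMode_mul_tMode_step
        (hv.orbitMap_tInvMode_lower hjk) m n)
      simpa using this
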